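/- Let $\alpha>0$ and let $\xi=(\xi_k)_{k\ge 0}$ be a sequence of independent Poisson point processes on $[0,1]$, each of intensity $\alpha$ (with respect to Lebesgue measure). For a configuration $\eta=(\eta_k)_{k\ge 0}$ of point processes on $[0,1]$ and an atom $x$ of $\eta_0$, let $f(\eta,x)=(\eta'_k)_{k\ge 0}$ be the configuration given by $$\eta'_k=\eta_{k+1}\big|_{[0,x)}+\eta_k\big|_{(x,1]}\qquad(k\ge 0).$$ The bump tree $\gamma(\xi)$ is the rooted tree whose root carries the configuration $\xi$ and in which a vertex carrying a configuration $\eta$ has one child for each atom $x$ of $\eta_0$, and this child carries the configuration $f(\eta,x)$. Let $D\in\{1,2,\dots\}\cup\{\infty\}$ be the number of vertices of $\gamma(\xi)$, and let $\mathbf E_\alpha$ denote the expectation. Then $D$ is a random variable (measurable up to a null set), and: 1. if $\alpha\ge(\sqrt5-1)/2$, then $\mathbf E_\alpha[D^2]=\infty$; 2. if $\alpha<(3-\sqrt5)/2$, then $\mathbf E_\alpha[D^2]<\infty$. -/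

import Mathlib

open MeasureTheory ProbabilityTheory
open scoped NNReal ENNReal unitInterval

/-- `ξ` is a Poisson point process on `[0,1]` with intensity `α`, defined on `(Ω, P)`: a random
integer-valued Borel measure whose value on each Borel set `E` is Poisson of mean `α * |E|` and
whose values on pairwise disjoint Borel sets are independent. -/
structure IsPoissonPointProcess {Ω : Type*} [MeasurableSpace Ω] (P : Measure Ω) (α : ℝ≥0)
    (ξ : Ω → Measure I) : Prop where
  measurable : Measurable ξ
  integer_valued : ∀ ω, ∀ E : Set I, MeasurableSet E → ∃ n : ℕ, ξ ω E = n
  poisson : ∀ E : Set I, MeasurableSet E →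
    P.map (fun ω => ξ ω E) =
      (poissonMeasure (α * (volume E).toNNReal)).map (fun n : ℕ => (n : ℝ≥0∞))
  indep : ∀ (m : ℕ) (E : Fin m → Set I), (∀ i, MeasurableSet (E i)) →
    Pairwise (fun i j => Disjoint (E i) (E j)) → iIndepFun (fun i ω => ξ ω (E i)) P

/-- `ξ = (ξ_k)_{k ≥ 0}` is a sequence of independent Poisson point processes on `[0,1]`, each of
intensity `α`. -/
structure IsPoissonConfiguration {Ω : Type*} [MeasurableSpace Ω] (P : Measure Ω) (α : ℝ≥0)
    (ξ : ℕ → Ω → Measure I) : Prop where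
  poisson : ∀ k, IsPoissonPointProcess P α (ξ k)
  indep : iIndepFun ξ P

/-- The bump map: `ξ'_k = ξ_{k+1}|_{[0,x)} + ξ_k|_{(x,1]}`. -/
noncomputable def bump (ξ : ℕ → Measure I) (x : I) : ℕ → Measure I :=
  fun k => (ξ (k + 1)).restrict (Set.Iio x) + (ξ k).restrict (Set.Ioi x)

/-- `IsBumpSeq ξ [x₁, …, x_j]`: starting from `ξ`, one may bump successively `x₁, …, x_j`, each
being an atom of the process of index `0` of the configuration reached when it is bumped. -/
def IsBumpSeq : (ℕ → Measure I) → List I → Prop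
  | _, [] => True
  | ξ, x :: l => ξ 0 {x} ≠ 0 ∧ IsBumpSeq (bump ξ x) l

/-- The vertex set of the bump tree of `ξ`. A vertex is encoded by the sequence of atoms bumped on
the path from the root to it: the root is `[]`, and the children of `l` are the `l ++ [x]`, where
`x` runs through the atoms of the process of index `0` of the configuration at `l`. -/
def bumpTree (ξ : ℕ → Measure I) : Set (List I) := {l | IsBumpSeq ξ l}

/-- The number of vertices of the bump tree of `ξ`, possibly infinite. -/
noncomputable def bumpTreeSize (ξ : ℕ → Measure I) : ℝ≥0∞ := ((bumpTree ξ).encard : ℝ≥0∞)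

/-! Cut `[0,1]` into `N` cells and treat every charged cell as one atom. The tree of this discrete
model has at most as many vertices as the bump tree, and its size tends to that of the bump tree as
`N → ∞`, because finitely many vertices involve finitely many atoms, which a fine subdivision
separates (`discreteSize_le`, `tendsto_discreteSize`). This gives measurability; domination serves
for divergence, and Fatou's lemma for finiteness.

The discrete model is solved by inserting cells from right to left. A cell lying below all the
others loses one level at each earlier bump and affects no other cell, so it may occupy position `c`
exactly when it is charged at level `c` (`IsAtomSeq.append_cons_iff`). Each new cell uses fresh
independent Bernoulli variables, whence a closed recursion for the mixed second moments `M(a,b)`,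
where `a`, `b` are the lengths of two sequences built so far. With time scaled so that all the cells
take time `α`, its formal limit is `M'(a,b) = (a+1) M(a+1,b) + (b+1) M(a,b+1) + (min a b + 1)
M(a+1,b+1)`, `M = 1` at time `0`.

Upper bound: since `min a b + 1 ≤ (a+b+2)/2`, the power `u^(a+b+2)` with `u' = u^2 + u^3/2` is a
supersolution, finite for times below `log (3/2) > (3-√5)/2`. Lower bound: keeping track of `m = min
a b` only, `z^(m+1)` with `z' = 2z + z^2` is a subsolution, which explodes at time `(log 3)/2 <
(√5-1)/2`. -/

/-! ### Bump sequences over a linear order -/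

/-- The combinatorial counterpart of `IsBumpSeq`, for a family of predicates `B k` ("`x` is an atom
of level `k`") on an ordered type. -/
def IsAtomSeq {T : Type*} [LT T] : (ℕ → T → Prop) → List T → Prop
  | _, [] => True
  | B, x :: l => B 0 x ∧ IsAtomSeq (fun k y => (y < x ∧ B (k + 1) y) ∨ (x < y ∧ B k y)) l

theorem bump_singleton_ne_zero (ξ : ℕ → Measure I) (x y : I) (k : ℕ) :
    bump ξ x k {y} ≠ 0 ↔ (y < x ∧ ξ (k + 1) {y} ≠ 0) ∨ (x < y ∧ ξ k {y} ≠ 0) := by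
  have h1 : (ξ (k + 1)).restrict (Set.Iio x) {y} = if y < x then ξ (k + 1) {y} else 0 := by
    rw [Measure.restrict_apply (measurableSet_singleton y)]
    split_ifs with h
    · rw [Set.inter_eq_left.2 (by simpa using h)]
    · rw [Set.singleton_inter_eq_empty.2 (by simpa using h), measure_empty]
  have h2 : (ξ k).restrict (Set.Ioi x) {y} = if x < y then ξ k {y} else 0 := by
    rw [Measure.restrict_apply (measurableSet_singleton y)]
    split_ifs with h
    · rw [Set.inter_eq_left.2 (by simpa using h)]
    · rw [Set.singleton_inter_eq_empty.2 (by simpa using h), measure_empty]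
  simp only [bump, Measure.add_apply, h1, h2]
  split_ifs <;> simp_all [imp_iff_not_or]

theorem isBumpSeq_iff (ξ : ℕ → Measure I) (l : List I) :
    IsBumpSeq ξ l ↔ IsAtomSeq (fun k x => ξ k {x} ≠ 0) l := by
  induction l generalizing ξ with
  | nil => simp [IsBumpSeq, IsAtomSeq]
  | cons x l ih => simp only [IsBumpSeq, IsAtomSeq, ih, bump_singleton_ne_zero]

namespace IsAtomSeq

variable {T U : Type*} [LinearOrder T] [LinearOrder U]

theorem congr {B C : ℕ → T → Prop} {l : List T} (h : ∀ k, ∀ x ∈ l, B k x ↔ C k x) :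
    IsAtomSeq B l ↔ IsAtomSeq C l := by
  induction l generalizing B C with
  | nil => simp [IsAtomSeq]
  | cons x l ih =>
    simp only [IsAtomSeq]
    rw [h 0 x (by simp), ih]
    intro k y hy
    rw [h k y (by simp [hy]), h (k + 1) y (by simp [hy])]

theorem notMem {B : ℕ → T → Prop} {l : List T} {x : T} (hx : ∀ k, ¬ B k x)
    (h : IsAtomSeq B l) : x ∉ l := by
  induction l generalizing B with
  | nil => simp
  | cons y l ih =>
    obtain ⟨h0, h1⟩ := h
    have hne : x ≠ y := by rintro rfl; exact hx 0 h0
    have := ih (fun k => by simp [hx]) h1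
    simp [hne, this]

theorem nodup {B : ℕ → T → Prop} {l : List T} (h : IsAtomSeq B l) : l.Nodup := by
  induction l generalizing B with
  | nil => simp
  | cons y l ih =>
    obtain ⟨h0, h1⟩ := h
    exact List.nodup_cons.2 ⟨notMem (fun k => by simp) h1, ih h1⟩

/-- An element below all the others may be inserted in position `c` if and only if it is an atom of
level `c`, and it does not affect the others. -/
theorem append_cons_iff {B : ℕ → T → Prop} {l₁ l₂ : List T} {i : T}
    (h₁ : ∀ x ∈ l₁, i < x) (h₂ : ∀ x ∈ l₂, i < x) :
    IsAtomSeq B (l₁ ++ i :: l₂) ↔ B l₁.length i ∧ IsAtomSeq B (l₁ ++ l₂) := by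
  induction l₁ generalizing B with
  | nil =>
    simp only [List.nil_append, IsAtomSeq, List.length_nil]
    rw [congr (C := B)]
    intro k x hx
    have := h₂ x hx
    simp [this, this.not_gt]
  | cons x l ih =>
    have hx := h₁ x (by simp)
    simp only [List.cons_append, IsAtomSeq, List.length_cons]
    rw [ih (fun y hy => h₁ y (by simp [hy]))]
    simp only [hx, hx.not_gt, true_and, false_and, or_false]
    tauto

theorem map {B : ℕ → T → Prop} {C : ℕ → U → Prop} {φ : T → U} (hφ : Monotone φ) {l : List T}
    (hinj : Set.InjOn φ {x | x ∈ l}) (hBC : ∀ k, ∀ x ∈ l, B k x → C k (φ x))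
    (h : IsAtomSeq B l) : IsAtomSeq C (l.map φ) := by
  induction l generalizing B C with
  | nil => simp [IsAtomSeq]
  | cons x l ih =>
    obtain ⟨h0, h1⟩ := h
    refine ⟨hBC 0 x (by simp) h0, ih (hinj.mono fun y hy => by simp_all) ?_ h1⟩
    have hlt : ∀ y ∈ x :: l, ∀ z ∈ x :: l, y < z → φ y < φ z := fun y hy z hz hyz =>
      lt_of_le_of_ne (hφ hyz.le) fun e => hyz.ne (hinj hy hz e)
    rintro k y hy (⟨hyx, hB⟩ | ⟨hyx, hB⟩)
    · exact Or.inl ⟨hlt y (by simp [hy]) x (by simp) hyx, hBC _ y (by simp [hy]) hB⟩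
    · exact Or.inr ⟨hlt x (by simp) y (by simp [hy]) hyx, hBC _ y (by simp [hy]) hB⟩

/-- Choose one atom in each fibre used: a monotone map reflects strict inequalities, so the lifted
points are compared as their images are. -/
theorem exists_map_eq {B : ℕ → T → Prop} {C : ℕ → U → Prop} {φ : T → U} (hφ : Monotone φ)
    (hCB : ∀ k i, C k i → ∃ x, φ x = i ∧ B k x) {l : List U} (h : IsAtomSeq C l) :
    ∃ l' : List T, IsAtomSeq B l' ∧ l'.map φ = l := by
  induction l generalizing B C with
  | nil => exact ⟨[], by simp [IsAtomSeq]⟩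
  | cons i l ih =>
    obtain ⟨h0, h1⟩ := h
    obtain ⟨x, rfl, hx⟩ := hCB 0 i h0
    obtain ⟨l', hl', rfl⟩ := ih (B := fun k y => (y < x ∧ B (k + 1) y) ∨ (x < y ∧ B k y)) (by
      rintro k j (⟨hj, hC⟩ | ⟨hj, hC⟩)
      · obtain ⟨y, rfl, hy⟩ := hCB _ _ hC
        exact ⟨y, rfl, Or.inl ⟨hφ.reflect_lt hj, hy⟩⟩
      · obtain ⟨y, rfl, hy⟩ := hCB _ _ hC
        exact ⟨y, rfl, Or.inr ⟨hφ.reflect_lt hj, hy⟩⟩) h1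
    exact ⟨x :: l', ⟨hx, hl'⟩, rfl⟩

end IsAtomSeq

/-- A point of mass zero has an open neighbourhood of mass less than `1`, hence of mass `0`; a
locally null set is null. -/
theorem exists_atom_of_integer_valued {μ : Measure I}
    (hμ : ∀ E : Set I, MeasurableSet E → ∃ n : ℕ, μ E = n) {E : Set I} (hE : μ E ≠ 0) :
    ∃ x ∈ E, μ {x} ≠ 0 := by
  by_contra! hcon
  have : IsFiniteMeasure μ := ⟨by obtain ⟨n, hn⟩ := hμ _ MeasurableSet.univ; simp [hn]⟩
  refine hE (measure_null_of_locally_null E fun x hx => ?_)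
  obtain ⟨U, hxU, hU, hlt⟩ := Set.exists_isOpen_lt_of_lt {x} (1 : ℝ≥0∞) (μ := μ) (by simp [hcon x hx])
  obtain ⟨n, hn⟩ := hμ U hU.measurableSet
  refine ⟨U, mem_nhdsWithin_of_mem_nhds (hU.mem_nhds (hxU rfl)), ?_⟩
  rw [hn] at hlt ⊢
  have : n < 1 := by exact_mod_cast hlt
  simp [Nat.lt_one_iff.1 this]

/-! ### Counting by insertion of the smallest element -/

/-- The number of ways to extend a sequence of length `a` of larger elements by interleaving
elements smaller than `n`, where `β c i` is the weight of inserting `i` in position `c`. -/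
noncomputable def extensionCount (β : ℕ → ℕ → ℝ≥0∞) : ℕ → ℕ → ℝ≥0∞
  | 0, _ => 1
  | n + 1, a => extensionCount β n a +
      (∑ c ∈ Finset.range (a + 1), β c n) * extensionCount β n (a + 1)

-- A sequence with entries at least `i` either avoids `i` or, having no repetition, contains it
-- once; in the latter case it is determined by the rest and the position `c` of `i`, and `c` is
-- admissible exactly when `B c i`.
open Classical in
theorem tsum_isAtomSeq_succ (B : ℕ → ℕ → Prop) (i : ℕ) (f : ℕ → ℝ≥0∞) :
    ∑' l : {l : List ℕ | IsAtomSeq B l ∧ ∀ x ∈ l, i ≤ x}, f (l : List ℕ).length =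
      ∑' l : {l : List ℕ | IsAtomSeq B l ∧ ∀ x ∈ l, i + 1 ≤ x}, (f (l : List ℕ).length +
        (∑ c ∈ Finset.range ((l : List ℕ).length + 1), if B c i then 1 else 0) *
          f ((l : List ℕ).length + 1)) := by
  set L := {l : List ℕ | IsAtomSeq B l ∧ ∀ x ∈ l, i + 1 ≤ x} with hL
  set s : Set (List ℕ × ℕ) := {q | q.1 ∈ L ∧ q.2 ≤ q.1.length ∧ B q.2 i} with hs
  let g : List ℕ × ℕ → List ℕ := fun q => q.1.take q.2 ++ i :: q.1.drop q.2
  have hlen : ∀ q ∈ s, (g q).length = q.1.length + 1 := by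
    rintro ⟨l, c⟩ ⟨-, hc, -⟩
    simp only [g, List.length_append, List.length_take, List.length_cons, List.length_drop]
    simp only at hc
    omega
  have hLnot : ∀ l ∈ L, i ∉ l := fun l hl hi => absurd (hl.2 i hi) (by omega)
  have hunion : {l : List ℕ | IsAtomSeq B l ∧ ∀ x ∈ l, i ≤ x} = L ∪ g '' s := by
    ext l
    constructor
    · rintro ⟨h1, h2⟩
      by_cases hi : i ∈ l
      · right
        obtain ⟨l₁, l₂, rfl⟩ := List.append_of_mem hi
        have hnd := h1.nodup
        have h3 : ∀ x ∈ l₁ ++ l₂, i < x := by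
          intro x hx
          refine lt_of_le_of_ne (h2 x (by simp at hx ⊢; tauto)) ?_
          rintro rfl
          rw [List.nodup_middle] at hnd
          exact (List.nodup_cons.1 hnd).1 hx
        have h4 := (IsAtomSeq.append_cons_iff (fun x hx => h3 x (by simp [hx]))
          (fun x hx => h3 x (by simp [hx]))).1 h1
        exact ⟨(l₁ ++ l₂, l₁.length), ⟨⟨h4.2, h3⟩, by simp, h4.1⟩, by simp [g]⟩
      · exact Or.inl ⟨h1, fun x hx => lt_of_le_of_ne (h2 x hx) (by rintro rfl; exact hi hx)⟩
    · rintro (⟨h1, h2⟩ | ⟨⟨l, c⟩, ⟨⟨h1, h2⟩, hc, hB⟩, rfl⟩)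
      · exact ⟨h1, fun x hx => (Nat.le_succ i).trans (h2 x hx)⟩
      · simp only at h1 h2 hc hB
        refine ⟨(IsAtomSeq.append_cons_iff (fun x hx => h2 x (List.mem_of_mem_take hx))
          (fun x hx => h2 x (List.mem_of_mem_drop hx))).2 ?_, ?_⟩
        · simpa [hc] using ⟨hB, h1⟩
        · intro x hx
          simp only [g, List.mem_append, List.mem_cons] at hx
          rcases hx with hx | rfl | hx
          · exact (Nat.le_succ i).trans (h2 x (List.mem_of_mem_take hx))
          · exact le_rfl
          · exact (Nat.le_succ i).trans (h2 x (List.mem_of_mem_drop hx))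
  have hdisj : Disjoint L (g '' s) := by
    rw [Set.disjoint_left]
    rintro _ hl ⟨q, -, rfl⟩
    exact hLnot _ hl (by simp [g])
  have hinj : Set.InjOn g s := by
    rintro ⟨l, c⟩ ⟨hl, hc, -⟩ ⟨l', c'⟩ ⟨hl', hc', -⟩ h
    simp only at hl hc hl' hc'
    have hidx : ∀ (l : List ℕ) (c : ℕ), i ∉ l → c ≤ l.length →
        (l.take c ++ i :: l.drop c).idxOf i = c := by
      intro l c hl hc
      rw [List.idxOf_append_of_notMem fun hm => hl (List.mem_of_mem_take hm)]
      simp [hc]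
    have hcc : c = c' := by
      rw [← hidx l c (hLnot l hl) hc, ← hidx l' c' (hLnot l' hl') hc']
      exact congrArg _ h
    subst hcc
    have hlen : (l.take c).length = (l'.take c).length := by simp [hc, hc']
    have h5 := List.append_inj h hlen
    have h6 : l = l' := by
      rw [← List.take_append_drop c l, ← List.take_append_drop c l', h5.1,
        (List.cons.inj h5.2).2]
    rw [h6]
  rw [hunion, ENNReal.summable.tsum_union_disjoint (f := fun l : List ℕ => f l.length) hdisj
    ENNReal.summable, tsum_image (fun l : List ℕ => f l.length) hinj, ENNReal.tsum_add]
  congr 1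
  rw [tsum_congr (g := fun q : s => f ((q : List ℕ × ℕ).1.length + 1))
    (fun q => by rw [hlen q q.2]),
    tsum_subtype s (fun q => f (q.1.length + 1)),
    ENNReal.tsum_prod (f := fun l c => s.indicator (fun q => f (q.1.length + 1)) (l, c)),
    tsum_subtype L (fun l => (∑ c ∈ Finset.range (l.length + 1), if B c i then 1 else 0) *
          f (l.length + 1))]
  refine tsum_congr fun l => ?_
  by_cases hl : l ∈ L
  · rw [Set.indicator_of_mem hl, tsum_eq_sum (s := Finset.range (l.length + 1)), Finset.sum_mul]
    · refine Finset.sum_congr rfl fun c hc => ?_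
      have : c ≤ l.length := by simpa [Nat.lt_succ_iff] using hc
      by_cases hB : B c i <;> simp [Set.indicator, hs, hl, this, hB]
    · intro c hc
      have : ¬ c ≤ l.length := by simpa [Nat.lt_succ_iff] using hc
      simp [Set.indicator, hs, this]
  · simp [Set.indicator, hs, hl]

-- The sum in `key` does not depend on `n`: at `n = 0` it counts all sequences, at `n = N` only the
-- empty one remains.
open Classical in
theorem encard_isAtomSeq_eq (B : ℕ → ℕ → Prop) (N : ℕ) (hB : ∀ k i, N ≤ i → ¬ B k i) :
    (({l | IsAtomSeq B l} : Set (List ℕ)).encard : ℝ≥0∞) =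
      extensionCount (fun k i => if B k i then 1 else 0) N 0 := by
  have key : ∀ n, (({l | IsAtomSeq B l} : Set (List ℕ)).encard : ℝ≥0∞) =
      ∑' l : {l : List ℕ | IsAtomSeq B l ∧ ∀ x ∈ l, n ≤ x},
        extensionCount (fun k i => if B k i then 1 else 0) n (l : List ℕ).length := by
    intro n
    induction n with
    | zero => simp only [extensionCount, ENNReal.tsum_set_one, zero_le, implies_true, and_true]
    | succ n ih => rw [ih, tsum_isAtomSeq_succ]; rfl
  have hN : {l : List ℕ | IsAtomSeq B l ∧ ∀ x ∈ l, N ≤ x} = {[]} := by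
    ext l
    constructor
    · rintro ⟨h1, h2⟩
      refine List.eq_nil_iff_forall_not_mem.2 fun x hx => ?_
      exact IsAtomSeq.notMem (fun k => hB k x (h2 x hx)) h1 hx
    · rintro rfl
      simp [IsAtomSeq]
  rw [key N, hN, tsum_singleton ([] : List ℕ)
    (fun l => extensionCount (fun k i => if B k i then 1 else 0) N l.length)]
  rfl

/-! ### Recursion for the second moments -/

/-- The second moment of the number of pairs of insertions of an element of weight `p` into
sequences of lengths `a` and `b`. -/
noncomputable def pairWeight (p : ℝ≥0) (a b : ℕ) : ℝ≥0 :=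
  ∑ c ∈ Finset.range (a + 1), ∑ d ∈ Finset.range (b + 1), if c = d then p else p ^ 2

/-- The mixed second moments of `extensionCount`, where the weights of the level `n` are
Bernoulli of parameter `p n`. -/
noncomputable def secondMoment (p : ℕ → ℝ≥0) : ℕ → ℕ → ℕ → ℝ≥0
  | 0, _, _ => 1
  | n + 1, a, b => secondMoment p n a b + (a + 1) * p n * secondMoment p n (a + 1) b +
      (b + 1) * p n * secondMoment p n a (b + 1) +
      pairWeight (p n) a b * secondMoment p n (a + 1) (b + 1)

theorem measurable_extensionCount {Ω : Type*} (m : MeasurableSpace Ω) (β : ℕ → ℕ → Ω → ℝ≥0∞)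
    (n : ℕ) (hβ : ∀ k, ∀ i < n, Measurable[m] (β k i)) (a : ℕ) :
    Measurable[m] (fun ω => extensionCount (fun k i => β k i ω) n a) := by
  induction n generalizing a with
  | zero => exact measurable_const
  | succ n ih =>
    simp only [extensionCount]
    have := ih (fun k i hi => hβ k i (by omega))
    exact (this a).add ((Finset.measurable_sum _ fun c _ => hβ c n (by omega)).mul (this (a + 1)))

/-- The weights of element `n` are independent of those of the elements below `n`, so each term of
the expanded product factors. Idempotence `hsq` makes the diagonal terms of `pairWeight` equal to
`p` instead of `p ^ 2`. -/
theorem lintegral_extensionCount_mul {Ω : Type*} [MeasurableSpace Ω] (P : Measure Ω)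
    [IsProbabilityMeasure P] (β : ℕ → ℕ → Ω → ℝ≥0∞) (p : ℕ → ℝ≥0)
    (hβ : ∀ k i, Measurable (β k i)) (hsq : ∀ k i ω, β k i ω * β k i ω = β k i ω)
    (hind : iIndepFun (fun q : ℕ × ℕ => β q.1 q.2) P) (hp : ∀ k i, ∫⁻ ω, β k i ω ∂P = p i)
    (n a b : ℕ) :
    ∫⁻ ω, extensionCount (fun k i => β k i ω) n a * extensionCount (fun k i => β k i ω) n b ∂P =
      secondMoment p n a b := by
  induction n generalizing a b with
  | zero => simp [extensionCount, secondMoment]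
  | succ n ih =>
    set h : ℕ → Ω → ℝ≥0∞ := fun a ω => extensionCount (fun k i => β k i ω) n a with hh
    have hhm : ∀ a, Measurable (h a) := fun a =>
      measurable_extensionCount _ β n (fun k i _ => hβ k i) a
    let m : ℕ × ℕ → MeasurableSpace Ω := fun q => MeasurableSpace.comap (β q.1 q.2) inferInstance
    have hm : ∀ q, m q ≤ ‹MeasurableSpace Ω› := fun q => (hβ q.1 q.2).comap_le
    let S : Set (ℕ × ℕ) := {q | q.2 < n}
    let T : Set (ℕ × ℕ) := {q | q.2 = n}
    have hST : Disjoint S T := by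
      rw [Set.disjoint_left]
      intro q hq hq'
      simp only [S, T, Set.mem_ofPred_eq] at hq hq'
      omega
    have hindST : Indep (⨆ q ∈ S, m q) (⨆ q ∈ T, m q) P := indep_iSup_of_disjoint hm hind hST
    have hle : ∀ (U : Set (ℕ × ℕ)), ⨆ q ∈ U, m q ≤ ‹MeasurableSpace Ω› := fun U =>
      iSup₂_le fun q _ => hm q
    have hβU : ∀ (U : Set (ℕ × ℕ)) (q : ℕ × ℕ), q ∈ U → Measurable[⨆ q ∈ U, m q] (β q.1 q.2) :=
      fun U q hq => (comap_measurable (β q.1 q.2)).mono (le_iSup₂ (f := fun q _ => m q) q hq) le_rfl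
    have hhS : ∀ a, Measurable[⨆ q ∈ S, m q] (h a) := fun a =>
      measurable_extensionCount _ β n (fun k i hi => hβU S (k, i) hi) a
    have hβT : ∀ c, Measurable[⨆ q ∈ T, m q] (β c n) := fun c => hβU T (c, n) rfl
    have hmul : ∀ (a b : ℕ) (g : Ω → ℝ≥0∞), Measurable[⨆ q ∈ T, m q] g →
        ∫⁻ ω, g ω * (h a ω * h b ω) ∂P = (∫⁻ ω, g ω ∂P) * secondMoment p n a b := by
      intro a b g hg
      rw [← ih a b]
      exact lintegral_mul_eq_lintegral_mul_lintegral_of_independent_measurableSpace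
        (hle T) (hle S) hindST.symm hg ((hhS a).mul (hhS b))
    have hone : ∀ a : ℕ, ∫⁻ ω, ∑ c ∈ Finset.range (a + 1), β c n ω ∂P = (a + 1) * p n := by
      intro a
      rw [lintegral_finsetSum _ fun c _ => hβ c n]
      simp [hp]
    have htwo : ∀ c d, ∫⁻ ω, β c n ω * β d n ω ∂P = if c = d then (p n : ℝ≥0∞) else p n ^ 2 := by
      intro c d
      split_ifs with hcd
      · subst hcd
        simp only [hsq, hp]
      · have h1 : IndepFun (β c n) (β d n) P :=
          hind.indepFun (i := (c, n)) (j := (d, n)) (by simpa using hcd)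
        have h2 := lintegral_mul_eq_lintegral_mul_lintegral_of_indepFun (hβ c n) (hβ d n) h1
        simp only [Pi.mul_apply, hp] at h2
        rw [h2, sq]
    have hpair : ∫⁻ ω, (∑ c ∈ Finset.range (a + 1), β c n ω) *
        (∑ d ∈ Finset.range (b + 1), β d n ω) ∂P = pairWeight (p n) a b := by
      have hβ2 : ∀ c d, Measurable (fun ω => β c n ω * β d n ω) := fun c d => (hβ c n).mul (hβ d n)
      simp only [Finset.sum_mul_sum]
      rw [lintegral_finsetSum _ fun c _ => Finset.measurable_sum _ fun d _ => hβ2 c d]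
      simp only [pairWeight]
      push_cast
      refine Finset.sum_congr rfl fun c _ => ?_
      rw [lintegral_finsetSum _ fun d _ => hβ2 c d]
      refine Finset.sum_congr rfl fun d _ => ?_
      rw [htwo]
      split_ifs <;> simp
    have hsumT : ∀ a, Measurable[⨆ q ∈ T, m q]
        (fun ω => ∑ c ∈ Finset.range (a + 1), β c n ω) := fun a =>
      Finset.measurable_sum _ fun c _ => hβT c
    have hsum : ∀ a, Measurable (fun ω => ∑ c ∈ Finset.range (a + 1), β c n ω) := fun a =>
      Finset.measurable_sum _ fun c _ => hβ c n
    have e : ∀ ω, extensionCount (fun k i => β k i ω) (n + 1) a *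
        extensionCount (fun k i => β k i ω) (n + 1) b =
        h a ω * h b ω + (∑ c ∈ Finset.range (a + 1), β c n ω) * (h (a + 1) ω * h b ω) +
        (∑ c ∈ Finset.range (b + 1), β c n ω) * (h a ω * h (b + 1) ω) +
        ((∑ c ∈ Finset.range (a + 1), β c n ω) * (∑ d ∈ Finset.range (b + 1), β d n ω)) *
          (h (a + 1) ω * h (b + 1) ω) := by
      intro ω
      simp only [extensionCount, hh]
      ring
    simp only [e]
    rw [lintegral_add_left, lintegral_add_left, lintegral_add_left, hmul _ _ _ (hsumT a),
      hmul _ _ _ (hsumT b),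
      hmul _ _ (fun ω => (∑ c ∈ Finset.range (a + 1), β c n ω) *
        ∑ d ∈ Finset.range (b + 1), β d n ω) ((hsumT a).mul (hsumT b)), hone, hone, hpair, ih]
    · simp [secondMoment]
    · exact (hhm a).mul (hhm b)
    · exact ((hhm a).mul (hhm b)).add ((hsum a).mul ((hhm _).mul (hhm _)))
    · exact (((hhm a).mul (hhm b)).add ((hsum a).mul ((hhm _).mul (hhm _)))).add
        ((hsum b).mul ((hhm _).mul (hhm _)))

theorem sum_range_diagonal (p : ℝ≥0) (a b : ℕ) :
    ∑ c ∈ Finset.range (a + 1), ∑ d ∈ Finset.range (b + 1), (if c = d then p else 0) =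
      (min a b + 1 : ℕ) * p := by
  simp only [Finset.sum_ite_eq]
  rw [← Finset.sum_filter, Finset.sum_const, nsmul_eq_mul]
  congr 2
  rw [← Finset.card_range (min a b + 1)]
  congr 1
  ext c
  simp only [Finset.mem_filter, Finset.mem_range]
  omega

theorem le_pairWeight (p : ℝ≥0) (a b : ℕ) : (min a b + 1 : ℕ) * p ≤ pairWeight p a b := by
  rw [← sum_range_diagonal, pairWeight]
  gcongr
  split_ifs <;> simp

theorem pairWeight_le (p : ℝ≥0) (a b : ℕ) :
    pairWeight p a b ≤ (min a b + 1 : ℕ) * p + (a + 1) * (b + 1) * p ^ 2 := by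
  have : (a + 1 : ℝ≥0) * (b + 1) * p ^ 2 =
      ∑ c ∈ Finset.range (a + 1), ∑ d ∈ Finset.range (b + 1), p ^ 2 := by
    simp [mul_assoc]
  rw [← sum_range_diagonal, this, ← Finset.sum_add_distrib, pairWeight]
  refine Finset.sum_le_sum fun c _ => ?_
  rw [← Finset.sum_add_distrib]
  refine Finset.sum_le_sum fun d _ => ?_
  split_ifs <;> simp

/-! ### Upper bound by a supersolution -/

/-- A discretization, with step `δ`, of the solution of `u' = u ^ 2 + u ^ 3 / 2`, `u 0 = 1`. -/
noncomputable def envelope (δ : ℝ) : ℕ → ℝ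
  | 0 => 1
  | n + 1 => envelope δ n * Real.exp (δ * (envelope δ n + envelope δ n ^ 2 / 2))

theorem envelope_pos (δ : ℝ) (n : ℕ) : 0 < envelope δ n := by
  induction n with
  | zero => simp [envelope]
  | succ n ih => exact mul_pos ih (Real.exp_pos _)

/-- Bound `min a b + 1` by `(a+b+2)/2` and `(a+1)(b+1)` by `(a+b+2)^2/4`. The exponential in
`envelope` is there so that its quadratic Taylor term absorbs the `δ ^ 2` contribution of the
off-diagonal pairs. -/
theorem secondMoment_le_envelope {p : ℕ → ℝ≥0} {δ : ℝ} (hp : ∀ i, (p i : ℝ) ≤ δ) (n a b : ℕ) :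
    (secondMoment p n a b : ℝ) ≤ envelope δ n ^ (a + b + 2) := by
  induction n generalizing a b with
  | zero => simp [secondMoment, envelope]
  | succ n ih =>
    have hδ : 0 ≤ δ := (p 0).coe_nonneg.trans (hp 0)
    have hpn := hp n
    set x := envelope δ n with hx
    have hx0 : 0 < x := envelope_pos δ n
    have hpw : (pairWeight (p n) a b : ℝ) ≤
        ((a + b + 2 : ℝ) / 2) * δ + ((a + b + 2 : ℝ) ^ 2 / 4) * δ ^ 2 := by
      have h1 : (pairWeight (p n) a b : ℝ) ≤
          (min a b + 1 : ℕ) * (p n : ℝ) + (a + 1) * (b + 1) * (p n : ℝ) ^ 2 := by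
        exact_mod_cast pairWeight_le (p n) a b
      refine h1.trans ?_
      have h2 : ((min a b + 1 : ℕ) : ℝ) ≤ (a + b + 2) / 2 := by
        rw [le_div_iff₀ two_pos]
        have : (min a b + 1) * 2 ≤ a + b + 2 := by omega
        exact_mod_cast this
      have h3 : ((a : ℝ) + 1) * (b + 1) ≤ (a + b + 2) ^ 2 / 4 := by
        nlinarith [sq_nonneg ((a : ℝ) - b)]
      gcongr
    have hexp := Real.quadratic_le_exp_of_nonneg
      (x := ((a + b + 2 : ℕ) : ℝ) * (δ * (x + x ^ 2 / 2))) (by positivity)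
    have henv : envelope δ (n + 1) ^ (a + b + 2) =
        x ^ (a + b + 2) * Real.exp (((a + b + 2 : ℕ) : ℝ) * (δ * (x + x ^ 2 / 2))) := by
      rw [envelope, mul_pow, ← Real.exp_nat_mul]
    rw [henv]
    refine le_trans ?_ (mul_le_mul_of_nonneg_left hexp (by positivity))
    have i1 := ih a b
    have i2 := ih (a + 1) b
    have i3 := ih a (b + 1)
    have i4 := ih (a + 1) (b + 1)
    simp only [secondMoment]
    push_cast
    calc (secondMoment p n a b : ℝ) + (a + 1) * p n * secondMoment p n (a + 1) b +
          (b + 1) * p n * secondMoment p n a (b + 1) +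
          pairWeight (p n) a b * secondMoment p n (a + 1) (b + 1)
        ≤ x ^ (a + b + 2) + (a + 1) * δ * x ^ (a + 1 + b + 2) + (b + 1) * δ * x ^ (a + (b + 1) + 2)
          + (((a + b + 2 : ℝ) / 2) * δ + ((a + b + 2 : ℝ) ^ 2 / 4) * δ ^ 2) *
            x ^ (a + 1 + (b + 1) + 2) := by gcongr
      _ = x ^ (a + b + 2) * (1 + (a + b + 2) * (δ * (x + x ^ 2 / 2)) +
            ((a + b + 2) * δ * x) ^ 2 / 4) := by
          rw [show a + 1 + b + 2 = (a + b + 2) + 1 by ring,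
            show a + (b + 1) + 2 = (a + b + 2) + 1 by ring,
            show a + 1 + (b + 1) + 2 = (a + b + 2) + 2 by ring]
          ring
      _ ≤ x ^ (a + b + 2) * (1 + (a + b + 2) * (δ * (x + x ^ 2 / 2)) +
            ((a + b + 2) * (δ * (x + x ^ 2 / 2))) ^ 2 / 2) := by
          gcongr ?_ * (_ + ?_)
          have h4 : ((a + b + 2) * δ * x) ^ 2 ≤ ((a + b + 2) * (δ * (x + x ^ 2 / 2))) ^ 2 := by
            rw [mul_assoc]
            gcongr
            nlinarith
          nlinarith [sq_nonneg (((a : ℝ) + b + 2) * δ * x)]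

/-- In continuous time `v = u⁻²` satisfies `v' = -2 u⁻¹ - 1 ≥ -v - 2`, since `2 u⁻¹ ≤ u⁻² + 1`;
hence `v ≥ 3 e^(-t) - 2`. This is the Euler version. -/
theorem le_inv_envelope_sq {δ : ℝ} (hδ0 : 0 ≤ δ) (hδ1 : δ ≤ 1) (n : ℕ) :
    3 * (1 - δ) ^ n - 2 ≤ (envelope δ n ^ 2)⁻¹ := by
  induction n with
  | zero => norm_num [envelope]
  | succ n ih =>
    set x := envelope δ n with hx
    have hx0 : 0 < x := envelope_pos δ n
    have h1 : (envelope δ (n + 1) ^ 2)⁻¹ = (x ^ 2)⁻¹ * Real.exp (-(2 * (δ * (x + x ^ 2 / 2)))) := by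
      rw [envelope, mul_pow, mul_inv, ← Real.exp_nat_mul, ← Real.exp_neg]
      norm_num [hx]
    have h2 := Real.one_sub_le_exp_neg (2 * (δ * (x + x ^ 2 / 2)))
    have h3 : (x ^ 2)⁻¹ * (1 - 2 * (δ * (x + x ^ 2 / 2))) = (x ^ 2)⁻¹ - 2 * δ * x⁻¹ - δ := by
      field_simp
      ring
    have h4 : 2 * x⁻¹ ≤ (x ^ 2)⁻¹ + 1 := by
      rw [← inv_pow]
      nlinarith [sq_nonneg (x⁻¹ - 1)]
    rw [h1]
    refine le_trans ?_ (mul_le_mul_of_nonneg_left h2 (by positivity))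
    rw [h3, pow_succ]
    nlinarith [mul_le_mul_of_nonneg_left h4 hδ0, mul_le_mul_of_nonneg_left ih (sub_nonneg.2 hδ1)]

theorem exists_bound_secondMoment {α : ℝ} (hα0 : 0 ≤ α) (hα : α < (3 - Real.sqrt 5) / 2) :
    ∃ C : ℝ≥0, ∀ᶠ N : ℕ in Filter.atTop, ∀ p : ℕ → ℝ≥0, (∀ i, (p i : ℝ) ≤ α / N) →
      secondMoment p (N + 1) 0 0 ≤ C := by
  have h5 : (2.236 : ℝ) ≤ Real.sqrt 5 := Real.le_sqrt_of_sq_le (by norm_num)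
  have hexp : 2 / 3 < Real.exp (-α) := by
    -- `0.385` lies between `(3 - √5)/2 ≈ 0.382` and `log (3/2) ≈ 0.405`.
    have h1 : Real.exp (0.385 : ℝ) < 3 / 2 := by
      have := Real.exp_bound' (x := 0.385) (by norm_num) (by norm_num) (n := 5) (by norm_num)
      refine this.trans_lt ?_
      norm_num [Finset.sum_range_succ, Nat.factorial]
    have h2 : Real.exp α < 3 / 2 := (Real.exp_le_exp.2 (by linarith)).trans_lt h1
    rw [Real.exp_neg, lt_inv_comm₀ (by norm_num) (Real.exp_pos _)]
    simpa using h2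
  set c := (3 * Real.exp (-α) - 2) / 2 with hc
  have hc0 : 0 < c := by rw [hc]; linarith
  have hlim : Filter.Tendsto (fun N : ℕ => 3 * (1 - α / N) ^ (N + 1) - 2) Filter.atTop
      (nhds (2 * c)) := by
    have h1 := Real.tendsto_one_add_div_pow_exp (-α)
    have h2 : Filter.Tendsto (fun N : ℕ => 1 - α / N) Filter.atTop (nhds (1 - 0)) :=
      tendsto_const_nhds.sub (tendsto_const_div_atTop_nhds_zero_nat α)
    have h3 := ((h1.mul h2).const_mul 3).sub_const 2
    have : 2 * c = 3 * (Real.exp (-α) * (1 - 0)) - 2 := by rw [hc]; ring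
    rw [this]
    refine h3.congr fun N => ?_
    rw [pow_succ, neg_div, ← sub_eq_add_neg]
  refine ⟨(c⁻¹).toNNReal, ?_⟩
  filter_upwards [hlim.eventually (lt_mem_nhds (show c < 2 * c by linarith)),
    Filter.eventually_ge_atTop 1] with N hN hN1 p hp
  have hN1' : (1 : ℝ) ≤ N := by exact_mod_cast hN1
  have hα1 : α / N ≤ 1 := by
    rw [div_le_one (by linarith)]
    linarith
  have h1 := (secondMoment_le_envelope hp (N + 1) 0 0)
  have h2 := le_inv_envelope_sq (by positivity) hα1 (N + 1)
  have h3 : envelope (α / N) (N + 1) ^ 2 ≤ c⁻¹ := by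
    rw [le_inv_comm₀ (pow_pos (envelope_pos _ _) 2) hc0]
    linarith
  rw [← NNReal.coe_le_coe, Real.coe_toNNReal _ (by positivity)]
  exact h1.trans h3

/-! ### Lower bound by a Riccati equation -/

/-- The weighted number of paths of `K` steps from `m`, where a step from `m` stays with weight
`2 * (m + 1)` and goes to `m + 1` with weight `m + 1`. -/
def pathWeight : ℕ → ℕ → ℕ
  | 0, _ => 1
  | K + 1, m => (m + 1) * (2 * pathWeight K m + pathWeight K (m + 1))

theorem pathWeight_le_succ (K m : ℕ) : pathWeight K m ≤ pathWeight K (m + 1) := by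
  induction K generalizing m with
  | zero => simp [pathWeight]
  | succ K ih =>
    simp only [pathWeight]
    have := ih m
    have := ih (m + 1)
    gcongr
    omega

/-- Equality on the diagonal. Off it, one of the two single insertions already raises the minimum,
and monotonicity in `m` makes up for the change. -/
theorem pathWeight_succ_le (K a b : ℕ) :
    pathWeight (K + 1) (min a b) ≤ (a + 1) * pathWeight K (min (a + 1) b) +
      (b + 1) * pathWeight K (min a (b + 1)) +
      (min a b + 1) * pathWeight K (min (a + 1) (b + 1)) := by
  simp only [pathWeight]
  rcases lt_trichotomy a b with h | rfl | h
  · rw [min_eq_left h.le, min_eq_left (by omega : a + 1 ≤ b), min_eq_left (by omega : a ≤ b + 1),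
      min_eq_left (by omega : a + 1 ≤ b + 1)]
    have h1 := pathWeight_le_succ K a
    nlinarith [Nat.mul_le_mul_left (a + 1) h1, Nat.mul_le_mul_right (pathWeight K a) h.le]
  · simp only [min_self, Nat.le_succ, min_eq_left, min_eq_right]
    exact le_of_eq (by ring)
  · rw [min_eq_right h.le, min_eq_right (by omega : b ≤ a + 1),
      min_eq_right (by omega : b + 1 ≤ a), min_eq_right (by omega : b + 1 ≤ a + 1)]
    have h1 := pathWeight_le_succ K b
    nlinarith [Nat.mul_le_mul_left (b + 1) h1, Nat.mul_le_mul_right (pathWeight K b) h.le]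

theorem secondMoment_le_succ (p : ℕ → ℝ≥0) (n a b : ℕ) :
    secondMoment p n a b ≤ secondMoment p (n + 1) a b := by
  simp only [secondMoment, add_assoc]
  exact le_self_add

theorem one_le_secondMoment (p : ℕ → ℝ≥0) (n a b : ℕ) : 1 ≤ secondMoment p n a b := by
  induction n with
  | zero => simp [secondMoment]
  | succ n ih => exact ih.trans (secondMoment_le_succ p n a b)

/-- Select the `K` elements out of `n` that are inserted in at least one of the two sequences;
Pascal's rule matches the recursion. -/
theorem le_secondMoment {p : ℕ → ℝ≥0} {N : ℕ} {q : ℝ≥0} (hp : ∀ i < N, q ≤ p i) (n K a b : ℕ)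
    (hn : n ≤ N) :
    (n.choose K : ℝ≥0) * q ^ K * pathWeight K (min a b) ≤ secondMoment p n a b := by
  induction n generalizing K a b with
  | zero =>
    cases K with
    | zero => simp [pathWeight, secondMoment]
    | succ K => simp
  | succ n ih =>
    cases K with
    | zero => simpa [pathWeight] using one_le_secondMoment p (n + 1) a b
    | succ K =>
      have hn' : n ≤ N := by omega
      have hq := hp n (by omega)
      have i0 := ih (K + 1) a b hn'
      have i1 := ih K (a + 1) b hn'
      have i2 := ih K a (b + 1) hn'
      have i3 := ih K (a + 1) (b + 1) hn'
      have hstep : (pathWeight (K + 1) (min a b) : ℝ≥0) ≤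
          (a + 1) * pathWeight K (min (a + 1) b) + (b + 1) * pathWeight K (min a (b + 1)) +
          (min a b + 1 : ℕ) * pathWeight K (min (a + 1) (b + 1)) := by
        exact_mod_cast pathWeight_succ_le K a b
      have hpw : (min a b + 1 : ℕ) * q ≤ pairWeight (p n) a b :=
        (mul_le_mul_right hq _).trans (le_pairWeight _ a b)
      rw [Nat.choose_succ_succ]
      calc (((n.choose K + n.choose (K + 1) : ℕ) : ℝ≥0)) * q ^ (K + 1) *
            pathWeight (K + 1) (min a b)
          = n.choose (K + 1) * q ^ (K + 1) * pathWeight (K + 1) (min a b) +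
            n.choose K * q ^ (K + 1) * pathWeight (K + 1) (min a b) := by push_cast; ring
        _ ≤ n.choose (K + 1) * q ^ (K + 1) * pathWeight (K + 1) (min a b) +
            n.choose K * q ^ (K + 1) * ((a + 1) * pathWeight K (min (a + 1) b) +
              (b + 1) * pathWeight K (min a (b + 1)) +
              (min a b + 1 : ℕ) * pathWeight K (min (a + 1) (b + 1))) := by gcongr
        _ = n.choose (K + 1) * q ^ (K + 1) * pathWeight (K + 1) (min a b) +
            (a + 1) * q * (n.choose K * q ^ K * pathWeight K (min (a + 1) b)) +
            (b + 1) * q * (n.choose K * q ^ K * pathWeight K (min a (b + 1))) +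
            ((min a b + 1 : ℕ) * q) *
              (n.choose K * q ^ K * pathWeight K (min (a + 1) (b + 1))) := by ring
        _ ≤ secondMoment p (n + 1) a b := by
            rw [secondMoment]
            gcongr

/-- The Taylor coefficients of the solution of `z' = 2 z + z ^ 2`, `z 0 = 1`. -/
noncomputable def riccatiCoeff : ℕ → ℝ
  | 0 => 1
  | n + 1 => (2 * riccatiCoeff n + ∑ i : Fin (n + 1), riccatiCoeff i * riccatiCoeff (n - i)) / (n + 1)

theorem riccatiCoeff_succ_mul (n : ℕ) : riccatiCoeff (n + 1) * (n + 1) =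
    2 * riccatiCoeff n + ∑ i ∈ Finset.range (n + 1), riccatiCoeff i * riccatiCoeff (n - i) := by
  rw [riccatiCoeff, div_mul_cancel₀ _ (by positivity),
    Finset.sum_range fun i => riccatiCoeff i * riccatiCoeff (n - i)]

theorem derivative_mk_riccatiCoeff :
    PowerSeries.derivative ℝ (PowerSeries.mk riccatiCoeff) =
      2 * PowerSeries.mk riccatiCoeff + PowerSeries.mk riccatiCoeff ^ 2 := by
  ext n
  rw [PowerSeries.coeff_derivative, PowerSeries.coeff_mk, riccatiCoeff_succ_mul, sq, two_mul, two_mul,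
    map_add, map_add, PowerSeries.coeff_mul, Finset.Nat.sum_antidiagonal_eq_sum_range_succ_mk]
  simp only [PowerSeries.coeff_mk]

/-- `(z^(m+1))' = (m+1)(2 z^(m+1) + z^(m+2))` is the recursion of `pathWeight`. -/
theorem pathWeight_eq_coeff (K m : ℕ) : (pathWeight K m : ℝ) =
    K.factorial * PowerSeries.coeff K (PowerSeries.mk riccatiCoeff ^ (m + 1)) := by
  induction K generalizing m with
  | zero => simp [pathWeight, riccatiCoeff]
  | succ K ih =>
    have h := congrArg (PowerSeries.coeff K) (Derivation.leibniz_pow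
      (PowerSeries.derivative ℝ) (a := PowerSeries.mk riccatiCoeff) (m + 1))
    rw [PowerSeries.coeff_derivative, derivative_mk_riccatiCoeff] at h
    have h2 : (m + 1) • PowerSeries.mk riccatiCoeff ^ (m + 1 - 1) •
        (2 * PowerSeries.mk riccatiCoeff + PowerSeries.mk riccatiCoeff ^ 2) =
        PowerSeries.C ((m + 1 : ℝ) * 2) * PowerSeries.mk riccatiCoeff ^ (m + 1) +
          PowerSeries.C (m + 1 : ℝ) * PowerSeries.mk riccatiCoeff ^ (m + 1 + 1) := by
      simp only [nsmul_eq_mul, smul_eq_mul, Nat.add_sub_cancel, map_mul, map_add, map_natCast,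
        map_one, map_ofNat]
      push_cast
      ring
    rw [h2, map_add, PowerSeries.coeff_C_mul, PowerSeries.coeff_C_mul] at h
    simp only [pathWeight]
    push_cast
    rw [ih, ih, Nat.factorial_succ]
    push_cast
    linear_combination (-(K.factorial : ℝ)) * h

/-- The rate `r = 1.7` needs `r^2 ≤ 3` to start and `2r ≤ 4` for the induction: the two end terms of
the convolution and the linear term give `4 r^(n+2)`, the middle ones `n r^(n+3)`. -/
theorem le_riccatiCoeff (n : ℕ) : (1.7 : ℝ) ^ (n + 2) ≤ riccatiCoeff (n + 1) := by
  induction n using Nat.strong_induction_on with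
  | _ n ih =>
    have hrec := riccatiCoeff_succ_mul n
    cases n with
    | zero =>
      simp [riccatiCoeff]
      norm_num
    | succ n =>
      have h0 : riccatiCoeff 0 = 1 := by simp [riccatiCoeff]
      have hn := ih n (by omega)
      have hmid : ∑ i ∈ Finset.range n, (1.7 : ℝ) ^ (n + 3) ≤
          ∑ i ∈ Finset.range n, riccatiCoeff (i + 1) * riccatiCoeff (n + 1 - (i + 1)) := by
        refine Finset.sum_le_sum fun i hi => ?_
        have hi' : i < n := Finset.mem_range.1 hi
        obtain ⟨j, rfl⟩ : ∃ j, n = i + j + 1 := ⟨n - i - 1, by omega⟩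
        have e : i + j + 1 + 1 - (i + 1) = j + 1 := by omega
        rw [e]
        calc (1.7 : ℝ) ^ (i + j + 1 + 3) = 1.7 ^ (i + 2) * 1.7 ^ (j + 2) := by ring
          _ ≤ _ := by
            gcongr
            · exact le_trans (by positivity) (ih i (by omega))
            · exact ih i (by omega)
            · exact ih j (by omega)
      rw [Finset.sum_range_succ, Finset.sum_range_succ'] at hrec
      simp only [Nat.sub_self, Nat.sub_zero, h0, one_mul, mul_one] at hrec
      rw [Finset.sum_const, Finset.card_range, nsmul_eq_mul] at hmid
      have hn2 : (0 : ℝ) < (n : ℝ) + 1 + 1 := by positivity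
      push_cast at hrec
      rw [← mul_le_mul_iff_left₀ hn2, hrec]
      have e1 : (1.7 : ℝ) ^ (n + 1 + 2) = 1.7 * 1.7 ^ (n + 2) := by ring
      have e2 : (1.7 : ℝ) ^ (n + 3) = 1.7 * 1.7 ^ (n + 2) := by ring
      simp only [e2, Nat.add_sub_add_right] at hmid
      rw [e1]
      have : (0 : ℝ) < 1.7 ^ (n + 2) := by positivity
      nlinarith

/-- The second moments are unbounded for intensities at least `(√5 - 1) / 2`. -/
theorem exists_lt_secondMoment {α : ℝ≥0} (hα : (Real.sqrt 5 - 1) / 2 ≤ α) (C : ℝ≥0) :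
    ∃ N : ℕ, ∀ p : ℕ → ℝ≥0, (∀ i < N, (p i : ℝ) = 1 - Real.exp (-(α / N))) →
      C < secondMoment p (N + 1) 0 0 := by
  have h5 : (2.236 : ℝ) ≤ Real.sqrt 5 := Real.le_sqrt_of_sq_le (by norm_num)
  have hα' : (0.618 : ℝ) ≤ α := by linarith
  -- `0.61` is slightly below `(√5 - 1)/2`, and `1.7 * 0.61 > 1`.
  obtain ⟨K, hK⟩ : ∃ K : ℕ, (C : ℝ) < (1.7 * 0.61) ^ K :=
    pow_unbounded_of_one_lt _ (by norm_num)
  have hev : ∀ᶠ N : ℕ in Filter.atTop, 0.61 * ((N : ℝ) + α) ≤ α * (N + 1 - (K + 1)) := by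
    have h1 : Filter.Tendsto (fun N : ℕ => ((α : ℝ) - 0.61) * N) Filter.atTop Filter.atTop :=
      tendsto_natCast_atTop_atTop.const_mul_atTop (by linarith)
    filter_upwards [h1.eventually_ge_atTop (0.61 * α + α * K)] with N hN
    linarith
  obtain ⟨N, hN, hNK⟩ := (hev.and (Filter.eventually_ge_atTop (K + 1))).exists
  refine ⟨N, fun p hp => ?_⟩
  have hN0 : (0 : ℝ) < N := by exact_mod_cast (by omega : 0 < N)
  -- From `1 - e^(-t) ≥ t/(1+t)` at `t = α/N`.
  set q : ℝ≥0 := α / (N + α) with hq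
  have hqp : ∀ i < N, q ≤ p i := by
    intro i hi
    rw [← NNReal.coe_le_coe, hp i hi, hq]
    have h1 : Real.exp (-(α / N)) ≤ (1 + (α : ℝ) / N)⁻¹ := by
      rw [Real.exp_neg]
      gcongr
      linarith [Real.add_one_le_exp ((α : ℝ) / N)]
    have h2 : (1 + (α : ℝ) / N)⁻¹ = 1 - α / (N + α) := by
      field_simp
      ring
    push_cast
    linarith
  have h1 := (le_secondMoment hqp N (K + 1) 0 0 le_rfl).trans (secondMoment_le_succ p N 0 0)
  refine lt_of_lt_of_le ?_ h1
  rw [← NNReal.coe_lt_coe]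
  push_cast
  rw [min_self, pathWeight_eq_coeff, zero_add, pow_one, PowerSeries.coeff_mk]
  have h2 : ((N : ℝ) + 1 - (K + 1)) ^ (K + 1) ≤ (K + 1).factorial * N.choose (K + 1) := by
    have h3 := Nat.pow_sub_le_descFactorial N (K + 1)
    rw [Nat.descFactorial_eq_factorial_mul_choose] at h3
    have h4 : ((N + 1 - (K + 1) : ℕ) : ℝ) = N + 1 - (K + 1) := by
      rw [Nat.cast_sub (by omega)]; push_cast; ring
    rw [← h4]
    exact_mod_cast h3
  have hrc : (1.7 : ℝ) ^ (K + 1) ≤ riccatiCoeff (K + 1) :=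
    (pow_le_pow_right₀ (by norm_num) (by omega)).trans (le_riccatiCoeff K)
  have hq61 : 0.61 ≤ ((N : ℝ) + 1 - (K + 1)) * q := by
    rw [hq]
    push_cast
    rw [mul_div_assoc', le_div_iff₀ (by positivity)]
    linarith
  have hNK' : (0 : ℝ) ≤ (N : ℝ) + 1 - (K + 1) := by
    have : ((K + 1 : ℕ) : ℝ) ≤ N := by exact_mod_cast hNK
    push_cast at this
    linarith
  calc (C : ℝ) < (1.7 * 0.61) ^ K := hK
    _ ≤ (1.7 * 0.61) ^ (K + 1) := pow_le_pow_right₀ (by norm_num) (by omega)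
    _ = 0.61 ^ (K + 1) * 1.7 ^ (K + 1) := by rw [mul_pow, mul_comm]
    _ ≤ (((N : ℝ) + 1 - (K + 1)) * q) ^ (K + 1) * riccatiCoeff (K + 1) := by gcongr
    _ = ((N : ℝ) + 1 - (K + 1)) ^ (K + 1) * (q ^ (K + 1) * riccatiCoeff (K + 1)) := by
        rw [mul_pow]; ring
    _ ≤ ((K + 1).factorial * N.choose (K + 1)) * (q ^ (K + 1) * riccatiCoeff (K + 1)) := by
        have : 0 ≤ riccatiCoeff (K + 1) := le_trans (by positivity) hrc
        gcongr
    _ = _ := by ring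

/-! ### Discretization of the bump tree -/

/-- The index of the cell containing `x`, in the subdivision of `[0,1]` into `N` cells of equal
length; the point `1` is alone in the cell `N`. -/
noncomputable def cellIndex (N : ℕ) (x : I) : ℕ := ⌊(N : ℝ) * x⌋₊

/-- The cell of index `i` of the subdivision of `[0,1]` into `N` cells of equal length. -/
def cell (N i : ℕ) : Set I := cellIndex N ⁻¹' {i}

theorem cellIndex_mono (N : ℕ) : Monotone (cellIndex N) := fun x y h =>
  Nat.floor_mono (mul_le_mul_of_nonneg_left (by exact_mod_cast h) (Nat.cast_nonneg N))

theorem measurableSet_cell (N i : ℕ) : MeasurableSet (cell N i) :=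
  (cellIndex_mono N).measurable (measurableSet_singleton i)

theorem cellIndex_le (N : ℕ) (x : I) : cellIndex N x ≤ N := by
  refine Nat.floor_le_of_le ?_
  exact mul_le_of_le_one_right (Nat.cast_nonneg N) x.2.2

theorem pairwise_disjoint_cell (N : ℕ) : Pairwise (fun i j => Disjoint (cell N i) (cell N j)) :=
  fun _ _ hij => Disjoint.preimage _ (Set.disjoint_singleton.2 hij)

theorem volume_cell {N i : ℕ} (hi : i < N) : volume (cell N i) = ENNReal.ofReal (1 / N) := by
  have hN : (0 : ℝ) < N := by exact_mod_cast (by omega : 0 < N)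
  have himage : Subtype.val '' (cell N i) = Set.Ico ((i : ℝ) / N) ((i + 1) / N) := by
    have hmem : ∀ x : ℝ, 0 ≤ x → (⌊(N : ℝ) * x⌋₊ = i ↔ x ∈ Set.Ico ((i : ℝ) / N) ((i + 1) / N)) := by
      intro x hx
      rw [Nat.floor_eq_iff (by positivity), Set.mem_Ico, div_le_iff₀ hN, lt_div_iff₀ hN, mul_comm]
    ext x
    constructor
    · rintro ⟨y, hy, rfl⟩
      exact (hmem y y.2.1).1 hy
    · intro hx
      have h0 : 0 ≤ x := le_trans (by positivity) hx.1
      have h1 : x ≤ 1 := by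
        refine hx.2.le.trans ?_
        rw [div_le_one hN]
        exact_mod_cast hi
      exact ⟨⟨x, h0, h1⟩, (hmem x h0).2 hx, rfl⟩
  rw [unitInterval.volume_apply, himage, Real.volume_Ico]
  congr 1
  ring

theorem volume_cell_eq_zero {N i : ℕ} (hN : 0 < N) (hi : N ≤ i) : volume (cell N i) = 0 := by
  refine measure_mono_null (t := {1}) (fun x hx => ?_) (measure_singleton _)
  have hx' : ⌊(N : ℝ) * x⌋₊ = i := hx
  have hN' : (0 : ℝ) < N := by exact_mod_cast hN
  have h1 : (N : ℝ) ≤ N * x := by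
    have := Nat.floor_le (a := (N : ℝ) * x) (mul_nonneg hN'.le x.2.1)
    rw [hx'] at this
    exact le_trans (by exact_mod_cast hi) this
  have h2 : (1 : ℝ) ≤ x := by nlinarith
  exact Subtype.ext (le_antisymm x.2.2 h2)

theorem eventually_injOn_cellIndex {F : Set I} (hF : F.Finite) :
    ∀ᶠ N in Filter.atTop, Set.InjOn (cellIndex N) F := by
  have h : ∀ᶠ N : ℕ in Filter.atTop, ∀ x ∈ F, ∀ y ∈ F, cellIndex N x = cellIndex N y → x = y := by
    rw [Filter.eventually_all_finite hF]
    intro x _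
    rw [Filter.eventually_all_finite hF]
    intro y _
    by_cases hxy : x = y
    · exact Filter.Eventually.of_forall fun _ _ => hxy
    have hpos : 0 < |(x : ℝ) - y| := abs_pos.2 (sub_ne_zero.2 fun e => hxy (Subtype.ext e))
    filter_upwards [(tendsto_natCast_atTop_atTop.atTop_mul_const hpos).eventually_ge_atTop (1 : ℝ)]
      with N hN heq
    exfalso
    have hx := Nat.floor_eq_iff (a := (N : ℝ) * x) (n := cellIndex N x)
      (mul_nonneg (Nat.cast_nonneg N) x.2.1) |>.1 rfl
    have hy := Nat.floor_eq_iff (a := (N : ℝ) * y) (n := cellIndex N y)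
      (mul_nonneg (Nat.cast_nonneg N) y.2.1) |>.1 rfl
    rw [heq] at hx
    have : |(N : ℝ) * x - N * y| < 1 := abs_sub_lt_iff.2 ⟨by linarith, by linarith⟩
    rw [← mul_sub, abs_mul, Nat.abs_cast] at this
    linarith
  filter_upwards [h] with N hN x hx y hy using hN x hx y hy

open Classical in
/-- The size of the bump tree of the configuration discretized into `N` cells. -/
noncomputable def discreteSize (N : ℕ) (η : ℕ → Measure I) : ℝ≥0∞ :=
  extensionCount (fun k i => if η k (cell N i) ≠ 0 then 1 else 0) (N + 1) 0

theorem discreteSize_eq_encard (N : ℕ) (η : ℕ → Measure I) :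
    discreteSize N η =
      (({l | IsAtomSeq (fun k i => η k (cell N i) ≠ 0) l} : Set (List ℕ)).encard : ℝ≥0∞) := by
  classical
  rw [encard_isAtomSeq_eq _ (N + 1)]
  · unfold discreteSize
    congr!
  · intro k i hi
    have : cell N i = ∅ := by
      refine Set.eq_empty_of_forall_notMem fun x hx => ?_
      have h1 : cellIndex N x = i := hx
      have h2 := cellIndex_le N x
      omega
    simp [this]

theorem discreteSize_le {η : ℕ → Measure I}
    (hη : ∀ k, ∀ E : Set I, MeasurableSet E → ∃ n : ℕ, η k E = n) (N : ℕ) :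
    discreteSize N η ≤ bumpTreeSize η := by
  rw [discreteSize_eq_encard, bumpTreeSize]
  have hsub : {l | IsAtomSeq (fun k i => η k (cell N i) ≠ 0) l} ⊆
      List.map (cellIndex N) '' bumpTree η := by
    intro l hl
    obtain ⟨l', hl', rfl⟩ := IsAtomSeq.exists_map_eq (B := fun k x => η k {x} ≠ 0)
      (cellIndex_mono N) (fun k i hi => exists_atom_of_integer_valued (hη k) hi) hl
    exact ⟨l', (isBumpSeq_iff η l').2 hl', rfl⟩
  exact_mod_cast (Set.encard_le_encard hsub).trans (Set.encard_image_le _ _)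

/-- Once the cells separate the finitely many points occurring in `n` chosen vertices, these
vertices project to distinct discrete sequences. -/
theorem eventually_le_discreteSize (η : ℕ → Measure I) {n : ℕ} (hn : n ≤ (bumpTree η).encard) :
    ∀ᶠ N in Filter.atTop, (n : ℝ≥0∞) ≤ discreteSize N η := by
  obtain ⟨t, ht, htn⟩ := Set.exists_subset_encard_eq hn
  have htfin : t.Finite := Set.finite_of_encard_eq_coe htn
  have hF : (⋃ l ∈ t, {x | x ∈ l}).Finite := htfin.biUnion fun l _ => List.finite_toSet l
  filter_upwards [eventually_injOn_cellIndex hF] with N hN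
  have hmem : ∀ l ∈ t, {x | x ∈ l} ⊆ ⋃ l ∈ t, {x | x ∈ l} := fun l hl =>
    Set.subset_biUnion_of_mem (u := fun l : List I => {x | x ∈ l}) hl
  have hinj : Set.InjOn (List.map (cellIndex N)) t := by
    refine Set.LeftInvOn.injOn (f₁' := List.map (Function.invFunOn (cellIndex N)
      (⋃ l ∈ t, {x | x ∈ l}))) fun l hl => ?_
    rw [List.map_map]
    conv_rhs => rw [← List.map_id l]
    exact List.map_congr_left fun x hx => hN.leftInvOn_invFunOn (hmem l hl hx)
  have hsub : List.map (cellIndex N) '' t ⊆ {l | IsAtomSeq (fun k i => η k (cell N i) ≠ 0) l} := by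
    rintro _ ⟨l, hl, rfl⟩
    refine IsAtomSeq.map (cellIndex_mono N) (hN.mono (hmem l hl)) (fun k x _ hx h0 => hx ?_)
      ((isBumpSeq_iff η l).1 (ht hl))
    exact measure_mono_null (by simp [cell]) h0
  rw [discreteSize_eq_encard]
  have h1 := Set.encard_le_encard hsub
  rw [hinj.encard_image, htn] at h1
  exact_mod_cast ENat.toENNReal_mono h1

theorem tendsto_discreteSize {η : ℕ → Measure I}
    (hη : ∀ k, ∀ E : Set I, MeasurableSet E → ∃ n : ℕ, η k E = n) :
    Filter.Tendsto (fun N => discreteSize N η) Filter.atTop (nhds (bumpTreeSize η)) := by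
  refine tendsto_order.2 ⟨fun c hc => ?_, fun c hc => Filter.Eventually.of_forall fun N =>
    (discreteSize_le hη N).trans_lt hc⟩
  obtain ⟨n, hcn, hn⟩ : ∃ n : ℕ, c < n ∧ n ≤ (bumpTree η).encard := by
    rw [bumpTreeSize] at hc
    induction h : (bumpTree η).encard using ENat.recTopCoe with
    | top =>
      obtain ⟨n, hn⟩ := ENNReal.exists_nat_gt hc.ne_top
      exact ⟨n, hn, le_top⟩
    | coe n => exact ⟨n, by simpa [h] using hc, le_rfl⟩
  filter_upwards [eventually_le_discreteSize η hn] with N hN using hcn.trans_le hN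

/-! ### Poisson input and conclusion -/

theorem IsPoissonPointProcess.measure_ne_zero {Ω : Type*} [MeasurableSpace Ω] {P : Measure Ω}
    {α : ℝ≥0} {ξ : Ω → Measure I} (hξ : IsPoissonPointProcess P α ξ) {E : Set I}
    (hE : MeasurableSet E) :
    P {ω | ξ ω E ≠ 0} =
      ((1 - Real.exp (-(α * (volume E).toNNReal : ℝ≥0))).toNNReal : ℝ≥0) := by
  have hm : Measurable (fun ω => ξ ω E) := (Measure.measurable_coe hE).comp hξ.measurable
  have hs : MeasurableSet ({0}ᶜ : Set ℝ≥0∞) := (measurableSet_singleton 0).compl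
  have h1 : P {ω | ξ ω E ≠ 0} = P.map (fun ω => ξ ω E) {0}ᶜ := by
    rw [Measure.map_apply hm hs]
    rfl
  have h2 : (fun n : ℕ => (n : ℝ≥0∞)) ⁻¹' {0}ᶜ = {0}ᶜ := by
    ext n
    simp
  rw [h1, hξ.poisson E hE, Measure.map_apply (measurable_of_countable _) hs, h2,
    prob_compl_eq_one_sub (measurableSet_singleton 0), poissonMeasure_singleton]
  simp only [pow_zero, Nat.factorial_zero, Nat.cast_one, mul_one, div_one]
  rw [← ENNReal.ofReal_one, ← ENNReal.ofReal_sub _ (Real.exp_pos _).le]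
  rfl

theorem IsPoissonConfiguration.iIndepFun_cell {Ω : Type*} [MeasurableSpace Ω] {P : Measure Ω}
    [IsProbabilityMeasure P] {α : ℝ≥0} {ξ : ℕ → Ω → Measure I}
    (hξ : IsPoissonConfiguration P α ξ) (N : ℕ) :
    iIndepFun (fun (q : ℕ × ℕ) ω => ξ q.1 ω (cell N q.2)) P := by
  refine iIndepFun_uncurry' (X := fun k i ω => ξ k ω (cell N i)) (fun k i =>
    (Measure.measurable_coe (measurableSet_cell N i)).comp (hξ.poisson k).measurable) ?_ ?_
  · exact hξ.indep.comp (fun _ (μ : Measure I) (i : ℕ) => μ (cell N i)) fun _ =>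
      measurable_pi_lambda _ fun i => Measure.measurable_coe (measurableSet_cell N i)
  · intro k
    rw [iIndepFun_iff_finset]
    intro s
    have h := (hξ.poisson k).indep s.card (fun j => cell N (s.equivFin.symm j))
      (fun j => measurableSet_cell N _) (fun i j hij => pairwise_disjoint_cell N
        fun e => hij (s.equivFin.symm.injective (Subtype.ext e)))
    have h2 := h.precomp s.equivFin.injective
    convert h2 using 2
    simp [Finset.restrict]

/-- The probability that a Poisson process of intensity `α` charges the cell `i`. -/
noncomputable def cellProb (α : ℝ≥0) (N i : ℕ) : ℝ≥0 :=
  (1 - Real.exp (-(α * (volume (cell N i)).toNNReal : ℝ≥0))).toNNReal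

theorem cellProb_of_lt {N i : ℕ} (α : ℝ≥0) (hi : i < N) :
    (cellProb α N i : ℝ) = 1 - Real.exp (-(α / N)) := by
  have h : (α * (volume (cell N i)).toNNReal : ℝ≥0) = (α / N : ℝ) := by
    rw [volume_cell hi, ENNReal.ofReal, ENNReal.toNNReal_coe, NNReal.coe_mul, Real.coe_toNNReal _ (by positivity)]
    ring
  rw [cellProb, h, Real.coe_toNNReal]
  rw [sub_nonneg, Real.exp_le_one_iff]
  exact neg_nonpos.2 (by positivity)

theorem cellProb_le {N : ℕ} (α : ℝ≥0) (hN : 0 < N) (i : ℕ) : (cellProb α N i : ℝ) ≤ α / N := by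
  rcases lt_or_ge i N with hi | hi
  · rw [cellProb_of_lt α hi]
    linarith [Real.one_sub_le_exp_neg ((α : ℝ) / N)]
  · rw [cellProb, volume_cell_eq_zero hN hi]
    simp only [ENNReal.toNNReal_zero, mul_zero, NNReal.coe_zero, neg_zero, Real.exp_zero, sub_self,
      Real.toNNReal_zero]
    positivity

theorem IsPoissonConfiguration.measurable_discreteSize {Ω : Type*} [MeasurableSpace Ω]
    {P : Measure Ω} {α : ℝ≥0} {ξ : ℕ → Ω → Measure I} (hξ : IsPoissonConfiguration P α ξ) (N : ℕ) :
    Measurable (fun ω => discreteSize N (fun k => ξ k ω)) := by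
  classical
  refine measurable_extensionCount _ (fun k i ω => if ξ k ω (cell N i) ≠ 0 then 1 else 0) _
    (fun k i _ => ?_) 0
  have hm := (Measure.measurable_coe (measurableSet_cell N i)).comp (hξ.poisson k).measurable
  exact Measurable.ite (hm (measurableSet_singleton 0).compl) measurable_const measurable_const

theorem IsPoissonConfiguration.lintegral_discreteSize_sq {Ω : Type*} [MeasurableSpace Ω]
    {P : Measure Ω} [IsProbabilityMeasure P] {α : ℝ≥0} {ξ : ℕ → Ω → Measure I}
    (hξ : IsPoissonConfiguration P α ξ) (N : ℕ) :
    ∫⁻ ω, discreteSize N (fun k => ξ k ω) ^ 2 ∂P = secondMoment (cellProb α N) (N + 1) 0 0 := by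
  classical
  have hg : Measurable (fun x : ℝ≥0∞ => if x ≠ 0 then (1 : ℝ≥0∞) else 0) :=
    Measurable.ite (measurableSet_singleton 0).compl measurable_const measurable_const
  have hm : ∀ k i, Measurable (fun ω => ξ k ω (cell N i)) := fun k i =>
    (Measure.measurable_coe (measurableSet_cell N i)).comp (hξ.poisson k).measurable
  simp only [sq, discreteSize]
  refine lintegral_extensionCount_mul P (fun k i ω => if ξ k ω (cell N i) ≠ 0 then 1 else 0)
    (cellProb α N) (fun k i => hg.comp (hm k i)) ?_ ?_ ?_ (N + 1) 0 0
  · intro k i ω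
    split_ifs <;> simp
  · exact (hξ.iIndepFun_cell N).comp (fun _ x => if x ≠ 0 then (1 : ℝ≥0∞) else 0) fun _ => hg
  · intro k i
    rw [cellProb, ← (hξ.poisson k).measure_ne_zero (measurableSet_cell N i)]
    rw [← lintegral_indicator_one (s := {ω | ξ k ω (cell N i) ≠ 0})
      (hm k i (measurableSet_singleton 0).compl)]
    exact lintegral_congr fun ω => by simp [Set.indicator]

theorem theorem3 {Ω : Type*} [MeasurableSpace Ω] (P : Measure Ω) [IsProbabilityMeasure P]
    (α : ℝ≥0) (hα : 0 < α) (ξ : ℕ → Ω → Measure I) (hξ : IsPoissonConfiguration P α ξ) :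
    AEMeasurable (fun ω => bumpTreeSize (fun k => ξ k ω)) P ∧
    ((Real.sqrt 5 - 1) / 2 ≤ (α : ℝ) →
      ∫⁻ ω, bumpTreeSize (fun k => ξ k ω) ^ 2 ∂P = ⊤) ∧
    ((α : ℝ) < (3 - Real.sqrt 5) / 2 →
      ∫⁻ ω, bumpTreeSize (fun k => ξ k ω) ^ 2 ∂P < ⊤) := by
  have hint : ∀ ω k, ∀ E : Set I, MeasurableSet E → ∃ n : ℕ, ξ k ω E = n := fun ω k =>
    (hξ.poisson k).integer_valued ω
  have hlim : ∀ ω, Filter.Tendsto (fun N => discreteSize N (fun k => ξ k ω)) Filter.atTop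
      (nhds (bumpTreeSize fun k => ξ k ω)) := fun ω => tendsto_discreteSize (hint ω)
  refine ⟨(measurable_of_tendsto_metrizable (hξ.measurable_discreteSize)
    (tendsto_pi_nhds.2 hlim)).aemeasurable, fun h => ?_, fun h => ?_⟩
  · refine ENNReal.eq_top_of_forall_nnreal_le fun C => ?_
    obtain ⟨N, hN⟩ := exists_lt_secondMoment h C
    have h1 := hN (cellProb α N) fun i hi => cellProb_of_lt α hi
    calc (C : ℝ≥0∞) ≤ secondMoment (cellProb α N) (N + 1) 0 0 := by exact_mod_cast h1.le
      _ = ∫⁻ ω, discreteSize N (fun k => ξ k ω) ^ 2 ∂P := (hξ.lintegral_discreteSize_sq N).symm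
      _ ≤ _ := lintegral_mono fun ω => by
        gcongr
        exact discreteSize_le (hint ω) N
  · obtain ⟨C, hC⟩ := exists_bound_secondMoment α.coe_nonneg h
    refine lt_of_le_of_lt ?_ (ENNReal.coe_lt_top (r := C))
    have hsq : ∀ ω, bumpTreeSize (fun k => ξ k ω) ^ 2 =
        Filter.liminf (fun N => discreteSize N (fun k => ξ k ω) ^ 2) Filter.atTop := fun ω =>
      (((ENNReal.continuous_pow 2).tendsto _).comp (hlim ω)).liminf_eq.symm
    simp only [hsq]
    -- Fatou's lemma is used because the subdivisions are not nested, so monotonicity in `N` is not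
    -- available.
    refine (lintegral_liminf_le fun N => (hξ.measurable_discreteSize N).pow_const 2).trans ?_
    simp only [hξ.lintegral_discreteSize_sq]
    refine Filter.liminf_le_of_frequently_le' (Filter.Eventually.frequently ?_)
    filter_upwards [hC, Filter.eventually_gt_atTop 0] with N hN hN0
    exact_mod_cast hN _ (cellProb_le α hN0)
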